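/- Let $d\ge 3$ be an integer, let $m\ge 0$, and let $T_m(\eta)=\sqrt{|\eta|^2+m^2}-m$ for $\eta\in\mathbb{R}^d$. Let $T_m(p)=\sqrt{|p|^2+m^2}-m$, $p=-i\nabla$, be the corresponding Fourier multiplier on $L^2(\mathbb{R}^d)$, with form domain $\mathcal{Q}(T_m(p))=\{u\in L^2(\mathbb{R}^d):\int T_m(\eta)|\hat u(\eta)|^2\,d\eta<\infty\}$. Let $V:\mathbb{R}^d\to\mathbb{R}$ be a measurable potential that is relatively form compact with respect to $T_m(p)$, i.e. the operator $(T_m(p)+1)^{-1/2}|V|(T_m(p)+1)^{-1/2}$ is compact on $L^2(\mathbb{R}^d)$, and let $T_m(p)+V$ be the operator defined by the sum of quadratic forms on $\mathcal{Q}(T_m(p))$. Denote by $N(\sqrt{|p|^2+m^2}-m+V)$ the number of its strictly negative eigenvalues, counted with multiplicity, and put $V_-=\max(0,-V)$. Then for every $0<\alpha<\tfrac14$ $$N\big(\sqrt{|p|^2+m^2}-m+V\big)\le\frac{\alpha^2}{(1-4\alpha)^2}\int_{\mathbb{R}^d}G_{d,m}\big(V_-(x)/\alpha^2\big)\,dx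 ,$$ where, for $u\ge 0$, $$G_{d,m}(u)=\frac{d}{d-2}\,\frac{|B_1^d|}{(2\pi)^d}\,u^{d/2}(u+2m)^{d/2}$$ and $|B_1^d|$ is the volume of the unit ball of $\mathbb{R}^d$. (The right-hand side may be $+\infty$.) -/

import Mathlib

open MeasureTheory
open scoped ENNReal FourierTransform ComplexConjugate

noncomputable section

namespace BoundStates

/-- Euclidean space `ℝ^d`. -/
abbrev Space (d : ℕ) : Type := EuclideanSpace ℝ (Fin d)

/-- The complex Hilbert space `L²(ℝ^d)`. -/
abbrev L2 (d : ℕ) : Type := Lp ℂ 2 (volume : Measure (Space d))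

variable {d : ℕ}

/-- The function `ξ ↦ g(2πξ) φ̂(ξ)`, where `φ̂` is the `L²` Fourier transform in the normalization
`φ̂(ξ) = ∫ e^{-2πi x·ξ} φ(x) dx`. In this normalization the momentum operator `p = -i∇` is
multiplication by `η = 2πξ`, so this function represents `g(p) φ` on the Fourier side. -/
def symbolMul (g : Space d → ℝ) (φ : L2 d) : Space d → ℂ :=
  fun ξ => (g ((2 * Real.pi) • ξ) : ℂ) * (𝓕 φ : L2 d) ξ

theorem symbolMul_zero (g : Space d → ℝ) : symbolMul g (0 : L2 d) =ᵐ[volume] 0 := by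
  have h0 : (𝓕 (0 : L2 d) : L2 d) = 0 := (Lp.fourierTransformₗᵢ (Space d) ℂ).map_zero
  filter_upwards with ξ
  simp [symbolMul, h0]

theorem symbolMul_add (g : Space d → ℝ) (φ ψ : L2 d) :
    symbolMul g (φ + ψ) =ᵐ[volume] symbolMul g φ + symbolMul g ψ := by
  have h0 : (𝓕 (φ + ψ) : L2 d) = 𝓕 φ + 𝓕 ψ :=
    (Lp.fourierTransformₗᵢ (Space d) ℂ).map_add φ ψ
  filter_upwards [Lp.coeFn_add (𝓕 φ : L2 d) (𝓕 ψ)] with ξ hξ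
  simp only [symbolMul, h0, hξ, Pi.add_apply, mul_add]

theorem symbolMul_smul (g : Space d → ℝ) (c : ℂ) (φ : L2 d) :
    symbolMul g (c • φ) =ᵐ[volume] c • symbolMul g φ := by
  have h0 : (𝓕 (c • φ) : L2 d) = c • 𝓕 φ :=
    (Lp.fourierTransformₗᵢ (Space d) ℂ).map_smul c φ
  filter_upwards [Lp.coeFn_smul c (𝓕 φ : L2 d)] with ξ hξ
  simp only [symbolMul, h0, hξ, Pi.smul_apply, smul_eq_mul]
  ring

/-- The maximal domain of the Fourier multiplier `g(p)`:
all `φ ∈ L²` for which `g(η) φ̂(η)` is square integrable. -/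
def multiplierDomain (g : Space d → ℝ) : Submodule ℂ (L2 d) where
  carrier := {φ | MemLp (symbolMul g φ) 2 volume}
  zero_mem' := (memLp_congr_ae (symbolMul_zero g)).2 MemLp.zero
  add_mem' {φ ψ} hφ hψ := (memLp_congr_ae (symbolMul_add g φ ψ)).2 (MemLp.add hφ hψ)
  smul_mem' c φ hφ := (memLp_congr_ae (symbolMul_smul g c φ)).2 (MemLp.const_smul hφ c)

open Classical in
/-- The Fourier multiplier `g(p) φ = 𝓕⁻¹ [g(·) φ̂(·)]` for `φ` in its domain
(and `0` by convention for other `φ`). -/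
def multiplier (g : Space d → ℝ) (φ : L2 d) : L2 d :=
  if h : MemLp (symbolMul g φ) 2 volume then 𝓕⁻ (h.toLp (symbolMul g φ)) else 0

/-- The form domain `Q(T(p))` of the operator `T(p)` with symbol `T ≥ 0`,
i.e. the domain of `T(p)^{1/2}`. -/
def formDomain (T : Space d → ℝ) : Submodule ℂ (L2 d) :=
  multiplierDomain fun η => √(T η)

/-- `V` is relatively form compact with respect to `T(p)`: the operator
`(T(p)+1)^{-1/2} |V| (T(p)+1)^{-1/2}` is a compact operator on `L²(ℝ^d)`. Here it is written as
`A† A` with `A = |V|^{1/2} (T(p)+1)^{-1/2}`, which has to be a bounded operator on all of `L²`. -/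
def IsRelFormCompact (T V : Space d → ℝ) : Prop :=
  ∃ A : L2 d →L[ℂ] L2 d,
    (∀ φ : L2 d, (A φ : Space d → ℂ) =ᵐ[volume] fun x =>
      (√|V x| : ℂ) * multiplier (fun η => (√(T η + 1))⁻¹) φ x) ∧
    IsCompactOperator ((ContinuousLinearMap.adjoint A).comp A)

/-- The sesquilinear form of the kinetic energy `T(p)`, conjugate linear in the first argument:
`⟨T(p)^{1/2} v, T(p)^{1/2} u⟩`, evaluated on the Fourier side. -/
def kineticForm (T : Space d → ℝ) (v u : L2 d) : ℂ :=
  ∫ ξ, conj (symbolMul (fun η => √(T η)) v ξ) * symbolMul (fun η => √(T η)) u ξ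

theorem integrable_kinetic {T : Space d → ℝ} {v u : L2 d}
    (hv : v ∈ formDomain T) (hu : u ∈ formDomain T) :
    Integrable (fun ξ => conj (symbolMul (fun η => √(T η)) v ξ) *
      symbolMul (fun η => √(T η)) u ξ) volume := by
  have hv' : MemLp (symbolMul (fun η => √(T η)) v) 2 volume := hv
  have hu' : MemLp (symbolMul (fun η => √(T η)) u) 2 volume := hu
  exact hv'.star.integrable_mul hu'

/-- The sesquilinear form of the potential, `⟨v, V u⟩ = ∫ V v̄ u dx`. -/
def potentialForm (V : Space d → ℝ) (v u : L2 d) : ℂ :=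
  ∫ x, (V x : ℂ) * (conj (v x) * u x)

/-- The graph of the operator `H = T(p) + V` associated with the sum of quadratic forms on
`Q(T(p))`: `u` is in the domain of `H` and `H u = f` iff `u ∈ Q(T(p))` and
`⟨T(p)^{1/2} v, T(p)^{1/2} u⟩ + ∫ V v̄ u dx = ⟨v, f⟩` for all `v ∈ Q(T(p))`.
The integrability of `V v̄ u` required here is automatic for all `u, v ∈ Q(T(p))`
if `V` is (measurable and) relatively form compact with respect to `T(p)`. -/
def hamiltonianGraph (T V : Space d → ℝ) : Submodule ℂ (L2 d × L2 d) where
  carrier := {p | p.1 ∈ formDomain T ∧ ∀ v ∈ formDomain T,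
    Integrable (fun x => (V x : ℂ) * (conj (v x) * p.1 x)) volume ∧
    kineticForm T v p.1 + potentialForm V v p.1 = inner ℂ v p.2}
  zero_mem' := by
    refine ⟨zero_mem _, fun v hv => ?_⟩
    have hz := symbolMul_zero (fun η => √(T η)) (d := d)
    have h1 : (fun x => (V x : ℂ) * (conj (v x) * (0 : L2 d) x)) =ᵐ[volume] fun _ => 0 := by
      filter_upwards with x
      simp
    have h2 : (fun ξ => conj (symbolMul (fun η => √(T η)) v ξ) *
        symbolMul (fun η => √(T η)) (0 : L2 d) ξ) =ᵐ[volume] fun _ => 0 := by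
      filter_upwards [hz] with x hx
      simp [hx]
    refine ⟨(integrable_congr h1).2 (integrable_zero _ _ _), ?_⟩
    simp only [kineticForm, potentialForm, Prod.fst_zero, Prod.snd_zero, inner_zero_right]
    rw [integral_congr_ae h1, integral_congr_ae h2]
    simp
  add_mem' := by
    intro p q hp hq
    refine ⟨add_mem hp.1 hq.1, fun v hv => ?_⟩
    obtain ⟨hp1, hp2⟩ := hp.2 v hv
    obtain ⟨hq1, hq2⟩ := hq.2 v hv
    have h1 : (fun x => (V x : ℂ) * (conj (v x) * (p.1 + q.1 : L2 d) x)) =ᵐ[volume]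
        fun x => (V x : ℂ) * (conj (v x) * p.1 x) + (V x : ℂ) * (conj (v x) * q.1 x) := by
      filter_upwards [Lp.coeFn_add p.1 q.1] with x hx
      rw [hx, Pi.add_apply]
      ring
    have h2 : (fun ξ => conj (symbolMul (fun η => √(T η)) v ξ) *
        symbolMul (fun η => √(T η)) (p.1 + q.1 : L2 d) ξ) =ᵐ[volume]
        fun ξ => conj (symbolMul (fun η => √(T η)) v ξ) * symbolMul (fun η => √(T η)) p.1 ξ +
          conj (symbolMul (fun η => √(T η)) v ξ) * symbolMul (fun η => √(T η)) q.1 ξ := by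
      filter_upwards [symbolMul_add (fun η => √(T η)) p.1 q.1] with x hx
      rw [hx, Pi.add_apply]
      ring
    refine ⟨(integrable_congr h1).2 (hp1.add hq1), ?_⟩
    simp only [kineticForm, potentialForm, Prod.fst_add, Prod.snd_add, inner_add_right] at *
    rw [integral_congr_ae h1, integral_congr_ae h2, integral_add hp1 hq1,
      integral_add (integrable_kinetic hv hp.1) (integrable_kinetic hv hq.1), ← hp2, ← hq2]
    ring
  smul_mem' := by
    intro c p hp
    refine ⟨Submodule.smul_mem _ c hp.1, fun v hv => ?_⟩
    obtain ⟨hp1, hp2⟩ := hp.2 v hv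
    have h1 : (fun x => (V x : ℂ) * (conj (v x) * (c • p.1 : L2 d) x)) =ᵐ[volume]
        fun x => c * ((V x : ℂ) * (conj (v x) * p.1 x)) := by
      filter_upwards [Lp.coeFn_smul c p.1] with x hx
      rw [hx, Pi.smul_apply, smul_eq_mul]
      ring
    have h2 : (fun ξ => conj (symbolMul (fun η => √(T η)) v ξ) *
        symbolMul (fun η => √(T η)) (c • p.1 : L2 d) ξ) =ᵐ[volume]
        fun ξ => c * (conj (symbolMul (fun η => √(T η)) v ξ) *
          symbolMul (fun η => √(T η)) p.1 ξ) := by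
      filter_upwards [symbolMul_smul (fun η => √(T η)) c p.1] with x hx
      rw [hx, Pi.smul_apply, smul_eq_mul]
      ring
    refine ⟨(integrable_congr h1).2 (hp1.const_mul c), ?_⟩
    simp only [kineticForm, potentialForm, Prod.smul_fst, Prod.smul_snd, inner_smul_right] at *
    rw [integral_congr_ae h1, integral_congr_ae h2, integral_const_mul, integral_const_mul,
      ← hp2]
    ring

/-- The eigenspace `{u : H u = μ u}` of `H = T(p) + V`. -/
def eigenspace (T V : Space d → ℝ) (μ : ℝ) : Submodule ℂ (L2 d) :=
  (hamiltonianGraph T V).comap (LinearMap.id.prod ((μ : ℂ) • LinearMap.id))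

/-- The number `N(T(p) + V) ∈ [0, ∞]` of strictly negative eigenvalues of `T(p) + V`,
counted with multiplicity. -/
def numNegEigenvalues (T V : Space d → ℝ) : ℝ≥0∞ :=
  ∑' μ : Set.Iio (0 : ℝ), (Cardinal.toENat (Module.rank ℂ (eigenspace T V μ)) : ℝ≥0∞)

/-- The relativistic kinetic energy symbol `T_m(η) = √(|η|² + m²) - m`. -/
def relSymbol (d : ℕ) (m : ℝ) (η : Space d) : ℝ := √(‖η‖ ^ 2 + m ^ 2) - m

/-- The function `G_{d,m}(u) = d/(d-2) · |B_1|/(2π)^d · u^{d/2} (u+2m)^{d/2}`,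
with `|B_1|` the volume of the unit ball in `ℝ^d`. -/
def GFun (d : ℕ) (m u : ℝ) : ℝ :=
  (d : ℝ) / ((d : ℝ) - 2) * (volume.real (Metric.ball (0 : Space d) 1) / (2 * Real.pi) ^ d) *
    u ^ ((d : ℝ) / 2) * (u + 2 * m) ^ ((d : ℝ) / 2)

end BoundStates

end

/-! This is Cwikel's method, run directly on an orthonormal family. On the span of finitely many
negative eigenspaces the form of `T + V` is nonpositive. Orthonormalising the image of this span
under `T^{1/2}` gives orthonormal `ψ i = T^{1/2} u i` with `1 ≤ ∫ V_- |u i|²`, and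
`numNegEigenvalues_le` reduces the theorem to bounding the size `n` of such families.

Put `f = √V_-` and `w ξ = T(2πξ)`. On the shell where `f/α` lies between `2^k` and `2^(k+1)`, split
`u i` in frequency at `w = 4^k`. Where `w ≥ 4^k`, Plancherel and a geometric sum over `k` show that
the pieces have total weighted norm squared at most `16 α²`. The pieces with `w < 4^k` therefore
carry at least `(1 - 4α)²` for each `i` (`one_sub_le_tsum_dyadicShell`). Summed over `i`, they are
controlled pointwise in `x` by Bessel's inequality, with bound `∫_{w < 4^k} 1/w`
(`sum_enorm_fourierInv_sq_le`).

Since `4^k < f²/α²` on the shell, this gives `n (1 - 4α)² ≤ ∫ f² ∫_{w < f²/α²} 1/w`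
(`card_mul_le_lintegral`). The inner integral is at most `G(u)/u` at `u = f²/α²`
(`lintegral_relSymbol_inv_le`). -/

namespace BoundStates

variable {d : ℕ}

/-! ### Fourier inversion: the `L²` transform versus the Fourier integral -/

theorem continuous_fourierInv_of_integrable {h : Space d → ℂ} (hi : Integrable h) :
    Continuous (𝓕⁻ h) :=
  VectorFourier.fourierIntegral_continuous Real.continuous_fourierChar
    (continuous_inner (𝕜 := ℝ) (E := Space d)).neg hi

theorem integral_fourierInv_smul_eq {φ h : Space d → ℂ} (hφ : Integrable φ)
    (hi : Integrable h) : ∫ x, 𝓕⁻ φ x • h x = ∫ x, φ x • 𝓕⁻ h x := by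
  have key := VectorFourier.integral_fourierIntegral_smul_eq_flip (L := -innerₗ (Space d))
    (μ := volume) (ν := volume) Real.continuous_fourierChar
    (continuous_inner (𝕜 := ℝ) (E := Space d)).neg hφ hi
  have hflip : (-innerₗ (Space d)).flip = -innerₗ (Space d) := by
    ext x y
    simp [real_inner_comm]
  rw [hflip] at key
  exact key

/-- For square integrable `h` that is also integrable, the inverse Fourier transform on `L²`
is given by the Fourier integral. -/
theorem coeFn_fourierInv_ae_eq (h : L2 d) (hi : Integrable (h : Space d → ℂ)) :
    (𝓕⁻ h : L2 d) =ᵐ[volume] 𝓕⁻ (h : Space d → ℂ) := by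
  apply ae_eq_of_integral_contDiff_smul_eq
  · exact (Lp.memLp _).locallyIntegrable (by norm_num)
  · exact (continuous_fourierInv_of_integrable hi).locallyIntegrable
  -- The `L²` transform agrees with the distributional one, so both sides are tested against a
  -- smooth compactly supported function and the transform is moved onto it.
  · intro g g_smooth g_cpt
    have hg₁ : HasCompactSupport (Complex.ofRealCLM ∘ g) := g_cpt.comp_left rfl
    have hg₂ : ContDiff ℝ ((⊤ : ℕ∞) : WithTop ℕ∞) (Complex.ofRealCLM ∘ g) := by fun_prop
    set φ := hg₁.toSchwartzMap hg₂ with hφ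
    have hφ' : ∀ x, φ x = (g x : ℂ) := fun x => rfl
    have e1 : Lp.toTemperedDistribution (𝓕⁻ h : L2 d) φ = Lp.toTemperedDistribution h (𝓕⁻ φ) := by
      rw [← Lp.fourierInv_toTemperedDistribution_eq]
      rfl
    rw [Lp.toTemperedDistribution_apply, Lp.toTemperedDistribution_apply] at e1
    have e2 : ∫ x, (𝓕⁻ φ : SchwartzMap (Space d) ℂ) x • h x = ∫ x, φ x • 𝓕⁻ (h : Space d → ℂ) x := by
      rw [← integral_fourierInv_smul_eq φ.integrable hi, SchwartzMap.fourierInv_coe]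
    have e3 := e1.trans e2
    simpa [hφ'] using e3

/-! ### The momentum-space integral of the inverse symbol -/

/-- In polar coordinates the radial density is `r^(d-1) r^(-2) = r^(d-3)`, integrable at the origin
because `d ≥ 3`; this is the source of the factor `d/(d-2)`. -/
theorem lintegral_ball_norm_sq_inv (hd : 3 ≤ d) {R : ℝ} (hR : 0 < R) :
    ∫⁻ ξ in Metric.ball (0 : Space d) R, ENNReal.ofReal (‖ξ‖ ^ 2)⁻¹ =
      ENNReal.ofReal ((d : ℝ) / ((d : ℝ) - 2) * volume.real (Metric.ball (0 : Space d) 1) *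
        R ^ (d - 2)) := by
  have hfr : Module.finrank ℝ (Space d) = d := by simp
  have : Nontrivial (Space d) :=
    Module.nontrivial_of_finrank_pos (R := ℝ) (by rw [hfr]; omega)
  have hpow : ∀ y ∈ Set.Ioo (0 : ℝ) R, y ^ (d - 1) • (y ^ 2)⁻¹ = y ^ (d - 3) := by
    intro y hy
    have : y ≠ 0 := hy.1.ne'
    rw [smul_eq_mul, show d - 1 = (d - 3) + 2 by omega, pow_add]
    field_simp
  have hint : IntegrableOn (fun ξ : Space d => (‖ξ‖ ^ 2)⁻¹) (Metric.ball 0 R) volume := by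
    rw [integrableOn_fun_norm_addHaar volume (f := fun y => (y ^ 2)⁻¹), hfr,
      integrableOn_congr_fun hpow measurableSet_Ioo]
    exact ((continuous_pow (d - 3)).integrableOn_Icc (a := 0) (b := R)).mono_set
      Set.Ioo_subset_Icc_self
  rw [← ofReal_integral_eq_lintegral_ofReal hint (Filter.Eventually.of_forall fun _ => by positivity)]
  congr 1
  have h1 : ∫ ξ in Metric.ball (0 : Space d) R, (‖ξ‖ ^ 2)⁻¹ =
      ∫ ξ : Space d, (Set.Iio R).indicator (fun y : ℝ => (y ^ 2)⁻¹) ‖ξ‖ := by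
    rw [← integral_indicator measurableSet_ball]
    congr 1 with ξ
    simp [Set.indicator]
  have h2 : ∫ y in Set.Ioi (0 : ℝ), y ^ (d - 1) • (Set.Iio R).indicator (fun y : ℝ => (y ^ 2)⁻¹) y
      = ∫ y in Set.Ioo 0 R, y ^ (d - 3) := by
    rw [← setIntegral_congr_fun measurableSet_Ioo hpow, ← integral_indicator measurableSet_Ioi,
      ← integral_indicator measurableSet_Ioo]
    congr 1 with y
    by_cases h0 : 0 < y <;> by_cases hyR : y < R <;> simp [Set.indicator, h0, hyR]
  have h3 : ∫ y in Set.Ioo 0 R, y ^ (d - 3) = R ^ (d - 2) / ((d : ℝ) - 2) := by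
    rw [← integral_Ioc_eq_integral_Ioo, ← intervalIntegral.integral_of_le hR.le, integral_pow,
      show d - 3 + 1 = d - 2 by omega]
    have : ((d - 3 : ℕ) : ℝ) = d - 3 := by
      rw [Nat.cast_sub hd]; norm_num
    rw [this, zero_pow (by omega)]
    congr 1
    · ring
    · ring
  rw [h1, integral_fun_norm_addHaar, hfr, h2, h3]
  simp only [nsmul_eq_mul, smul_eq_mul]
  ring

theorem relSymbol_nonneg (m : ℝ) (η : Space d) : 0 ≤ relSymbol d m η := by
  rw [relSymbol, sub_nonneg]
  exact Real.le_sqrt_of_sq_le (by nlinarith [sq_nonneg ‖η‖])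

theorem relSymbol_pos {m : ℝ} {η : Space d} (hη : η ≠ 0) : 0 < relSymbol d m η := by
  have : 0 < ‖η‖ := norm_pos_iff.2 hη
  rw [relSymbol, sub_pos]
  exact Real.lt_sqrt_of_sq_lt (by nlinarith)

theorem continuous_relSymbol (m : ℝ) : Continuous (relSymbol d m) := by
  unfold relSymbol
  fun_prop

theorem relSymbol_mul_add {m : ℝ} (η : Space d) :
    relSymbol d m η * (relSymbol d m η + 2 * m) = ‖η‖ ^ 2 := by
  have := Real.sq_sqrt (show 0 ≤ ‖η‖ ^ 2 + m ^ 2 by positivity)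
  rw [relSymbol]
  linear_combination this

/-- Shaped to match the bound `1/T ≤ (u + 2m)/|η|²` on `{T < u}`, integrated over the ball of radius
`√(u(u + 2m))/(2π)` that contains this set. -/
theorem GFun_eq (hd : 3 ≤ d) {m u : ℝ} (hm : 0 ≤ m) (hu : 0 < u) :
    GFun d m u / u = (u + 2 * m) / (2 * Real.pi) ^ 2 *
      ((d : ℝ) / ((d : ℝ) - 2) * volume.real (Metric.ball (0 : Space d) 1) *
        (√(u * (u + 2 * m)) / (2 * Real.pi)) ^ (d - 2)) := by
  have hum : 0 < u + 2 * m := by linarith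
  have h1 : u ^ ((d : ℝ) / 2) * (u + 2 * m) ^ ((d : ℝ) / 2) = √(u * (u + 2 * m)) ^ d := by
    rw [← Real.mul_rpow hu.le hum.le, Real.sqrt_eq_rpow, ← Real.rpow_mul_natCast (by positivity)]
    congr 1
    ring
  have h2 : √(u * (u + 2 * m)) ^ d = √(u * (u + 2 * m)) ^ (d - 2) * (u * (u + 2 * m)) := by
    nth_rw 3 [← Real.sq_sqrt (show 0 ≤ u * (u + 2 * m) by positivity)]
    rw [← pow_add]
    congr 1
    omega
  have h3 : (2 * Real.pi) ^ d = (2 * Real.pi) ^ (d - 2) * (2 * Real.pi) ^ 2 := by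
    rw [← pow_add]
    congr 1
    omega
  have hpi : (2 * Real.pi) ≠ 0 := by positivity
  rw [GFun, mul_assoc, h1, h2, h3, div_pow]
  field_simp

/-- The integral of `1 / T_m` over a sublevel set of `T_m` is bounded by `G_{d,m}(u) / u`. -/
theorem lintegral_relSymbol_inv_le (hd : 3 ≤ d) {m u : ℝ} (hm : 0 ≤ m) (hu : 0 < u) :
    ∫⁻ ξ in {ξ : Space d | relSymbol d m ((2 * Real.pi) • ξ) < u},
      ENNReal.ofReal (relSymbol d m ((2 * Real.pi) • ξ))⁻¹ ≤ ENNReal.ofReal (GFun d m u / u) := by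
  have hum : 0 < u + 2 * m := by linarith
  set R : ℝ := √(u * (u + 2 * m)) / (2 * Real.pi) with hRdef
  have hR : 0 < R := by positivity
  have hnorm : ∀ ξ : Space d, ‖(2 * Real.pi) • ξ‖ = 2 * Real.pi * ‖ξ‖ := fun ξ => by
    rw [norm_smul, Real.norm_of_nonneg (by positivity)]
  have hsub : {ξ : Space d | relSymbol d m ((2 * Real.pi) • ξ) < u} ⊆ Metric.ball 0 R := by
    intro ξ hξ
    have h0 := relSymbol_mul_add (m := m) ((2 * Real.pi) • ξ)
    have h1 := relSymbol_nonneg m ((2 * Real.pi) • ξ)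
    rw [hnorm] at h0
    rw [mem_ball_zero_iff, hRdef, lt_div_iff₀ (by positivity)]
    apply Real.lt_sqrt_of_sq_lt
    have hξ' : relSymbol d m ((2 * Real.pi) • ξ) < u := hξ
    nlinarith
  have hmeas : MeasurableSet {ξ : Space d | relSymbol d m ((2 * Real.pi) • ξ) < u} :=
    measurableSet_lt ((continuous_relSymbol m).measurable.comp (measurable_const_smul _))
      measurable_const
  calc _ ≤ ∫⁻ ξ in {ξ : Space d | relSymbol d m ((2 * Real.pi) • ξ) < u},
      ENNReal.ofReal ((u + 2 * m) / (2 * Real.pi) ^ 2) * ENNReal.ofReal (‖ξ‖ ^ 2)⁻¹ := by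
        refine setLIntegral_mono' hmeas fun ξ hξ => ?_
        rw [← ENNReal.ofReal_mul (by positivity)]
        apply ENNReal.ofReal_le_ofReal
        -- At the origin the symbol vanishes and its inverse is `0` by convention.
        rcases eq_or_ne ξ 0 with rfl | h0
        · simp [relSymbol, Real.sqrt_sq hm]
        · have hpos := relSymbol_pos (m := m) (smul_ne_zero (by positivity : 2 * Real.pi ≠ 0) h0)
          have h1 := relSymbol_mul_add (m := m) ((2 * Real.pi) • ξ)
          have hξ' : relSymbol d m ((2 * Real.pi) • ξ) < u := hξ
          have hn : 0 < ‖ξ‖ := norm_pos_iff.2 h0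
          rw [hnorm] at h1
          rw [← div_eq_mul_inv, div_div, ← mul_pow, ← h1, inv_eq_one_div,
            div_le_div_iff₀ hpos (by rw [h1]; positivity)]
          nlinarith
    _ ≤ ∫⁻ ξ in Metric.ball 0 R,
      ENNReal.ofReal ((u + 2 * m) / (2 * Real.pi) ^ 2) * ENNReal.ofReal (‖ξ‖ ^ 2)⁻¹ :=
        lintegral_mono_set hsub
    _ = _ := by
      rw [lintegral_const_mul _ (by fun_prop), lintegral_ball_norm_sq_inv hd hR,
        ← ENNReal.ofReal_mul (by positivity), GFun_eq hd hm hu]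

/-! ### Variational reduction to orthonormal families -/

section NegativeEigenvalues

variable {T V : Space d → ℝ}

theorem memLp_symbolMul (u : formDomain T) : MemLp (symbolMul (fun η => √(T η)) u.1) 2 volume :=
  u.2

/-- The operator `T(p)^{1/2}`, on the Fourier side. -/
noncomputable def sqrtSymbol (T : Space d → ℝ) : formDomain T →ₗ[ℂ] L2 d where
  toFun u := MemLp.toLp (symbolMul (fun η => √(T η)) u.1) (memLp_symbolMul u)
  map_add' u v := by
    rw [← MemLp.toLp_add (memLp_symbolMul u) (memLp_symbolMul v)]
    exact MemLp.toLp_congr _ _ (symbolMul_add _ _ _)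
  map_smul' c u := by
    rw [RingHom.id_apply, ← MemLp.toLp_const_smul c (memLp_symbolMul u)]
    exact MemLp.toLp_congr _ _ (symbolMul_smul _ _ _)

theorem coeFn_sqrtSymbol (u : formDomain T) :
    sqrtSymbol T u =ᵐ[volume] symbolMul (fun η => √(T η)) u.1 :=
  MemLp.coeFn_toLp (memLp_symbolMul u)

/-- Positivity of the symbol almost everywhere allows division by it; injectivity ensures that
`T^{1/2}` preserves the dimension of the negative subspace. -/
theorem sqrtSymbol_injective (hT : ∀ᵐ ξ : Space d, 0 < T ((2 * Real.pi) • ξ)) :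
    Function.Injective (sqrtSymbol T) := by
  rw [injective_iff_map_eq_zero]
  intro u hu
  have h1 : (𝓕 u.1 : L2 d) = 0 := by
    rw [Lp.eq_zero_iff_ae_eq_zero]
    have h2 := coeFn_sqrtSymbol u
    rw [hu] at h2
    filter_upwards [hT, h2, Lp.coeFn_zero ℂ 2 (volume : Measure (Space d))] with ξ h3 h4 h5
    rw [h5, symbolMul] at h4
    have h6 : (√(T ((2 * Real.pi) • ξ)) : ℂ) ≠ 0 := by
      exact_mod_cast (Real.sqrt_pos.2 h3).ne'
    simpa [h6] using h4.symm
  have h2 : u.1 = 0 := (Lp.fourierTransformₗᵢ (Space d) ℂ).map_eq_zero_iff.1 h1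
  exact Subtype.ext h2

theorem kineticForm_eq_inner (v u : formDomain T) :
    kineticForm T v.1 u.1 = inner ℂ (sqrtSymbol T v) (sqrtSymbol T u) := by
  rw [L2.inner_def, kineticForm]
  apply integral_congr_ae
  filter_upwards [coeFn_sqrtSymbol u, coeFn_sqrtSymbol v] with ξ h1 h2
  simp [h1, h2, mul_comm]

theorem conj_kineticForm (v u : L2 d) : conj (kineticForm T v u) = kineticForm T u v := by
  rw [kineticForm, ← integral_conj]
  congr 1 with ξ
  simp [mul_comm]

theorem conj_potentialForm (v u : L2 d) : conj (potentialForm V v u) = potentialForm V u v := by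
  rw [potentialForm, ← integral_conj]
  congr 1 with ξ
  simp [mul_comm]

theorem mem_eigenspace {μ : ℝ} {u : L2 d} :
    u ∈ eigenspace T V μ ↔ (u, (μ : ℂ) • u) ∈ hamiltonianGraph T V := Iff.rfl

/-- Both forms are Hermitian, so testing each eigenvalue equation with the other eigenvector gives
`(ν - μ)⟨u, v⟩ = 0`. -/
theorem orthogonalFamily_eigenspace (T V : Space d → ℝ) :
    OrthogonalFamily ℂ (fun μ : ℝ => eigenspace T V μ)
      fun μ => (eigenspace T V μ).subtypeₗᵢ := by
  intro μ ν hμν u v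
  have hu := mem_eigenspace.1 u.2
  have hv := mem_eigenspace.1 v.2
  have h1 := (hu.2 v.1 hv.1).2
  have h2 := (hv.2 u.1 hu.1).2
  simp only [inner_smul_right] at h1 h2
  have h3 := congrArg conj h1
  rw [map_add, conj_kineticForm, conj_potentialForm, h2, map_mul, Complex.conj_ofReal,
    inner_conj_symm] at h3
  have h4 : ((ν : ℂ) - μ) * inner ℂ u.1 v.1 = 0 := by
    rw [sub_mul, h3, sub_self]
  have h5 : (ν : ℂ) - μ ≠ 0 := sub_ne_zero.2 (by exact_mod_cast hμν.symm)
  exact (mul_eq_zero.1 h4).resolve_left h5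

/-- Independence makes each successive intersection trivial, so ranks add; counting in `ℕ∞` covers
infinite multiplicities. -/
theorem toENat_rank_sup {E : Type*} [AddCommGroup E] [Module ℂ E] {ι : Type*}
    {f : ι → Submodule ℂ E} (hf : iSupIndep f) (s : Finset ι) :
    Cardinal.toENat (Module.rank ℂ (s.sup f : Submodule ℂ E)) =
      ∑ i ∈ s, Cardinal.toENat (Module.rank ℂ (f i)) := by
  classical
  induction s using Finset.induction_on with
  | empty => simp
  | insert a s ha ih =>
    rw [Finset.sum_insert ha, ← ih, Finset.sup_insert, ← map_add,
      ← Submodule.rank_sup_add_rank_inf_eq]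
    have hd : Disjoint (f a) (s.sup f) :=
      (hf.supIndep' (insert a s)) (Finset.subset_insert a s) (Finset.mem_insert_self a s) ha
    rw [hd.eq_bot]
    simp

/-- On the span of finitely many eigenspaces with negative eigenvalues, the form of `T(p) + V` is
nonpositive. -/
theorem form_nonpos {s : Finset (Set.Iio (0 : ℝ))} {u : L2 d}
    (hu : u ∈ s.sup fun μ : Set.Iio (0 : ℝ) => eigenspace T V μ) :
    u ∈ formDomain T ∧ Integrable (fun x => (V x : ℂ) * (conj (u x) * u x)) volume ∧
      (kineticForm T u u + potentialForm V u u).re ≤ 0 := by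
  rw [Finset.sup_eq_iSup, Submodule.mem_iSup_finset_iff_exists_sum] at hu
  obtain ⟨w, rfl⟩ := hu
  set u : L2 d := ∑ μ ∈ s, (w μ : L2 d) with hudef
  -- The graph is a subspace, so `H u = ∑ μ w_μ`; testing with `u` and using orthogonality turns the
  -- form into `∑ μ ‖w_μ‖²`.
  have hg : (u, ∑ μ ∈ s, ((μ.1 : ℝ) : ℂ) • (w μ : L2 d)) ∈ hamiltonianGraph T V := by
    have : (u, ∑ μ ∈ s, ((μ.1 : ℝ) : ℂ) • (w μ : L2 d)) =
        ∑ μ ∈ s, ((w μ : L2 d), ((μ.1 : ℝ) : ℂ) • (w μ : L2 d)) := by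
      simp [Prod.ext_iff, Prod.fst_sum, Prod.snd_sum, hudef]
    rw [this]
    exact Submodule.sum_mem _ fun μ _ => mem_eigenspace.1 (w μ).2
  obtain ⟨h1, h2⟩ := hg.2 u hg.1
  refine ⟨hg.1, h1, ?_⟩
  have h3 := ((orthogonalFamily_eigenspace T V).comp
    (Subtype.val_injective (p := fun μ => μ ∈ Set.Iio (0 : ℝ)))).inner_sum
    (fun μ => w μ) (fun μ => ((μ.1 : ℝ) : ℂ) • w μ) s
  have h4 : inner ℂ u (∑ μ ∈ s, ((μ.1 : ℝ) : ℂ) • (w μ : L2 d)) =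
      ∑ μ ∈ s, ((μ.1 : ℝ) : ℂ) * inner ℂ (w μ : L2 d) (w μ) := by
    refine h3.trans (Finset.sum_congr rfl fun μ _ => ?_)
    exact inner_smul_right (w μ : L2 d) _ _
  rw [h2, h4, Complex.re_sum]
  refine Finset.sum_nonpos fun μ _ => ?_
  rw [Complex.re_ofReal_mul]
  exact mul_nonpos_of_nonpos_of_nonneg (le_of_lt μ.2)
    (inner_self_nonneg (𝕜 := ℂ) (x := (w μ : L2 d)))

/-- A nonpositive total form gives `‖T^{1/2}u‖² ≤ -∫ V|u|²`, and `-V ≤ V_-`. -/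
theorem ofReal_kineticForm_le {u : L2 d} (hV : AEMeasurable V volume) (hu : u ∈ formDomain T)
    (hi : Integrable (fun x => (V x : ℂ) * (conj (u x) * u x)) volume)
    (hle : (kineticForm T u u + potentialForm V u u).re ≤ 0) :
    ENNReal.ofReal (‖sqrtSymbol T ⟨u, hu⟩‖ ^ 2) ≤
      ∫⁻ x, ENNReal.ofReal (max 0 (-V x)) * ‖u x‖ₑ ^ 2 := by
  have hk : (kineticForm T u u).re = ‖sqrtSymbol T ⟨u, hu⟩‖ ^ 2 := by
    rw [kineticForm_eq_inner ⟨u, hu⟩ ⟨u, hu⟩, ← inner_self_eq_norm_sq (𝕜 := ℂ)]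
    rfl
  have hpt : ∀ x, (V x : ℂ) * (conj (u x) * u x) = ((V x * ‖u x‖ ^ 2 : ℝ) : ℂ) := fun x => by
    rw [Complex.conj_mul']
    push_cast
    rfl
  have hi' : Integrable (fun x => V x * ‖u x‖ ^ 2) volume := by
    simp_rw [hpt] at hi
    exact hi.re
  have hp : (potentialForm V u u).re = ∫ x, V x * ‖u x‖ ^ 2 := by
    rw [potentialForm]
    simp_rw [hpt]
    rw [integral_complex_ofReal, Complex.ofReal_re]
  rw [Complex.add_re, hk, hp] at hle
  have hneg : Integrable (fun x => max 0 (-V x) * ‖u x‖ ^ 2) volume := by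
    refine hi'.mono ((aemeasurable_const.max hV.neg).aestronglyMeasurable.mul
      ((Lp.aestronglyMeasurable u).norm.pow 2)) (Filter.Eventually.of_forall fun x => ?_)
    rw [norm_mul, norm_mul]
    gcongr
    rw [Real.norm_of_nonneg (le_max_left _ _)]
    exact max_le (norm_nonneg _) (neg_le_abs _)
  have h1 : ‖sqrtSymbol T ⟨u, hu⟩‖ ^ 2 ≤ ∫ x, max 0 (-V x) * ‖u x‖ ^ 2 := by
    have : ∫ x, -(V x * ‖u x‖ ^ 2) ≤ ∫ x, max 0 (-V x) * ‖u x‖ ^ 2 := by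
      refine integral_mono hi'.neg hneg fun x => ?_
      show -(V x * ‖u x‖ ^ 2) ≤ max 0 (-V x) * ‖u x‖ ^ 2
      rw [← neg_mul]
      gcongr
      exact le_max_right _ _
    rw [integral_neg] at this
    linarith
  refine (ENNReal.ofReal_le_ofReal h1).trans (le_of_eq ?_)
  rw [ofReal_integral_eq_lintegral_ofReal hneg (Filter.Eventually.of_forall fun x => by positivity)]
  congr 1 with x
  rw [ENNReal.ofReal_mul (le_max_left _ _), ENNReal.ofReal_pow (norm_nonneg _), ofReal_norm]

/-- A variational criterion for bounding the number of negative eigenvalues of `T(p) + V`. -/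
theorem numNegEigenvalues_le (hT : ∀ᵐ ξ : Space d, 0 < T ((2 * Real.pi) • ξ))
    (hV : AEMeasurable V volume) {C : ℝ≥0∞}
    (hC : ∀ (n : ℕ) (ψ u : Fin n → L2 d), Orthonormal ℂ ψ →
      (∀ i, ψ i =ᵐ[volume] symbolMul (fun η => √(T η)) (u i)) →
      (∀ i, 1 ≤ ∫⁻ x, ENNReal.ofReal (max 0 (-V x)) * ‖u i x‖ₑ ^ 2) → (n : ℝ≥0∞) ≤ C) :
    numNegEigenvalues T V ≤ C := by
  rw [numNegEigenvalues, ENNReal.tsum_eq_iSup_sum]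
  refine iSup_le fun s => ?_
  set M : Submodule ℂ (L2 d) := s.sup fun μ : Set.Iio (0 : ℝ) => eigenspace T V μ with hM
  have hind : iSupIndep fun μ : Set.Iio (0 : ℝ) => eigenspace T V μ :=
    (orthogonalFamily_eigenspace T V).independent.comp Subtype.val_injective
  have hrank := toENat_rank_sup hind s
  have hcast : ∑ μ ∈ s, (Cardinal.toENat (Module.rank ℂ (eigenspace T V μ)) : ℝ≥0∞) =
      ((Cardinal.toENat (Module.rank ℂ M) : ℕ∞) : ℝ≥0∞) := by
    rw [hM, hrank]
    exact (map_sum ENat.toENNRealRingHom _ _).symm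
  rw [hcast]
  have hfd : M ≤ formDomain T := fun u hu => (form_nonpos hu).1
  set Ψ : M →ₗ[ℂ] L2 d := (sqrtSymbol T).comp (Submodule.inclusion hfd) with hΨ
  have hinj : Function.Injective Ψ :=
    (sqrtSymbol_injective hT).comp (Submodule.inclusion_injective hfd)
  have hfin : ∀ n : ℕ, (n : Cardinal) ≤ Module.rank ℂ M → (n : ℝ≥0∞) ≤ C := by
    intro n hn
    rw [← rank_range_of_injective Ψ hinj, Module.le_rank_iff] at hn
    obtain ⟨v, hv⟩ := hn
    -- Orthonormalising inside the range of `T^{1/2}` keeps a preimage in `M` for every vector, so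
    -- nonpositivity of the form still applies.
    have hon := InnerProductSpace.gramSchmidtNormed_orthonormal hv
    set b := InnerProductSpace.gramSchmidtNormed ℂ v
    choose u hu using fun i => (b i).2
    have hψ : Orthonormal ℂ fun i => ((b i : L2 d)) :=
      hon.comp_linearIsometry (LinearMap.range Ψ).subtypeₗᵢ
    refine hC n (fun i => (b i : L2 d)) (fun i => (u i : L2 d)) hψ (fun i => ?_) fun i => ?_
    · rw [← hu i]
      exact coeFn_sqrtSymbol _
    · obtain ⟨h1, h2, h3⟩ := form_nonpos (u i).2
      have h4 := ofReal_kineticForm_le hV h1 h2 h3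
      have h5 : sqrtSymbol T ⟨u i, h1⟩ = b i := hu i
      rw [h5, hψ.1 i] at h4
      simpa using h4
  -- If the rank is infinite, `hfin` holds for every `n` and forces `C = ⊤`.
  induction h : Cardinal.toENat (Module.rank ℂ M) using ENat.recTopCoe with
  | top =>
    have : C = ⊤ := by
      refine ENNReal.eq_top_of_forall_nnreal_le fun r => ?_
      obtain ⟨n, hn⟩ := exists_nat_ge r
      refine le_trans ?_ (hfin n ?_)
      · exact_mod_cast hn
      · exact (Cardinal.natCast_le_aleph0).trans (Cardinal.toENat_eq_top.1 h)
    simp [this]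
  | coe n =>
    rw [ENat.toENNReal_coe]
    exact hfin n (Cardinal.toENat_eq_natCast.1 h).ge

end NegativeEigenvalues

/-! ### Plancherel for sharp frequency cutoffs -/

theorem lintegral_enorm_sq (g : L2 d) : ∫⁻ x, ‖g x‖ₑ ^ 2 = ENNReal.ofReal (‖g‖ ^ 2) := by
  have hi : Integrable (fun x => ‖g x‖ ^ 2) volume := (Lp.memLp g).integrable_norm_pow (by norm_num)
  have h1 : ‖g‖ ^ 2 = ∫ x, ‖g x‖ ^ 2 := by
    rw [← inner_self_eq_norm_sq (𝕜 := ℂ), L2.inner_def]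
    simp_rw [inner_self_eq_norm_sq_to_K]
    have : ∀ x, ((‖g x‖ : ℂ)) ^ 2 = ((‖g x‖ ^ 2 : ℝ) : ℂ) := fun x => by push_cast; rfl
    have h2 : ∫ x, ((‖g x‖ : ℂ)) ^ 2 = ((∫ x, ‖g x‖ ^ 2 : ℝ) : ℂ) := by
      simp_rw [this]
      exact integral_complex_ofReal
    exact (congrArg Complex.re h2).trans (Complex.ofReal_re _)
  rw [h1, ofReal_integral_eq_lintegral_ofReal hi (Filter.Eventually.of_forall fun x => by positivity)]
  congr 1 with x
  rw [ENNReal.ofReal_pow (norm_nonneg _), ofReal_norm]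

/-- The restriction of an `L²` function to a measurable set, extended by zero. -/
noncomputable def restrictTo {S : Set (Space d)} (hS : MeasurableSet S) (h : L2 d) : L2 d :=
  ((Lp.memLp h).indicator hS).toLp

theorem coeFn_restrictTo {S : Set (Space d)} (hS : MeasurableSet S) (h : L2 d) :
    restrictTo hS h =ᵐ[volume] S.indicator h :=
  MemLp.coeFn_toLp _

theorem restrictTo_add_compl {S : Set (Space d)} (hS : MeasurableSet S) (h : L2 d) :
    restrictTo hS h + restrictTo hS.compl h = h := by
  apply Lp.ext
  filter_upwards [Lp.coeFn_add (restrictTo hS h) (restrictTo hS.compl h), coeFn_restrictTo hS h,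
    coeFn_restrictTo hS.compl h] with x h1 h2 h3
  rw [h1, Pi.add_apply, h2, h3]
  exact Set.indicator_self_add_compl_apply S h x

theorem lintegral_fourierInv_restrictTo {S : Set (Space d)} (hS : MeasurableSet S) (h : L2 d) :
    ∫⁻ x, ‖(𝓕⁻ (restrictTo hS h) : L2 d) x‖ₑ ^ 2 = ∫⁻ ξ in S, ‖h ξ‖ₑ ^ 2 := by
  have h0 : ‖(𝓕⁻ (restrictTo hS h) : L2 d)‖ = ‖restrictTo hS h‖ :=
    (Lp.fourierTransformₗᵢ (Space d) ℂ).symm.norm_map _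
  rw [lintegral_enorm_sq, h0, ← lintegral_enorm_sq, ← lintegral_indicator hS]
  apply lintegral_congr_ae
  filter_upwards [coeFn_restrictTo hS h] with ξ hξ
  rw [hξ]
  by_cases hmem : ξ ∈ S <;> simp [hmem]

/-! ### Frequency splitting for a general weight -/

section Weight

variable {w : Space d → ℝ} {S : Set (Space d)}

/-- This kernel, modulated by a character, is the vector paired with `ψ i` in the Bessel inequality;
its square integrability also makes `1_S h = 1_S w^{-1/2} ψ` integrable. -/
theorem memLp_indicator_inv_sqrt (hw : Measurable w) (hw0 : ∀ ξ, 0 ≤ w ξ) (hS : MeasurableSet S)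
    (hfin : ∫⁻ ξ in S, ENNReal.ofReal (w ξ)⁻¹ ≠ ⊤) :
    MemLp (S.indicator fun ξ => (((√(w ξ))⁻¹ : ℝ) : ℂ)) 2 volume := by
  rw [memLp_indicator_iff_restrict hS]
  have hm : Measurable fun ξ => (((√(w ξ))⁻¹ : ℝ) : ℂ) :=
    Complex.measurable_ofReal.comp hw.sqrt.inv
  rw [memLp_two_iff_integrable_sq_norm hm.aestronglyMeasurable]
  have : (fun ξ => ‖(((√(w ξ))⁻¹ : ℝ) : ℂ)‖ ^ 2) = fun ξ => (w ξ)⁻¹ := by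
    ext ξ
    rw [Complex.norm_real, Real.norm_of_nonneg (by positivity), inv_pow, Real.sq_sqrt (hw0 ξ)]
  rw [this]
  refine ⟨hw.inv.aestronglyMeasurable, ?_⟩
  rw [hasFiniteIntegral_iff_ofReal (Filter.Eventually.of_forall fun ξ => inv_nonneg.2 (hw0 ξ))]
  exact hfin.lt_top

theorem indicator_fourier_ae_eq (hwpos : ∀ᵐ ξ, 0 < w ξ) {ψ h : L2 d}
    (hψ : ψ =ᵐ[volume] fun ξ => (√(w ξ) : ℂ) * h ξ) :
    S.indicator h =ᵐ[volume] fun ξ => S.indicator (fun ξ => (((√(w ξ))⁻¹ : ℝ) : ℂ)) ξ * ψ ξ := by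
  filter_upwards [hwpos, hψ] with ξ h1 h2
  by_cases hmem : ξ ∈ S
  · have : (√(w ξ) : ℂ) ≠ 0 := by exact_mod_cast (Real.sqrt_pos.2 h1).ne'
    simp only [hmem, Set.indicator_of_mem, h2]
    push_cast
    field_simp
  · simp [hmem]

theorem integrable_indicator_fourier (hw : Measurable w) (hw0 : ∀ ξ, 0 ≤ w ξ)
    (hwpos : ∀ᵐ ξ, 0 < w ξ) (hS : MeasurableSet S)
    (hfin : ∫⁻ ξ in S, ENNReal.ofReal (w ξ)⁻¹ ≠ ⊤) {ψ h : L2 d}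
    (hψ : ψ =ᵐ[volume] fun ξ => (√(w ξ) : ℂ) * h ξ) : Integrable (S.indicator h) volume :=
  ((memLp_indicator_inv_sqrt hw hw0 hS hfin).integrable_mul (Lp.memLp ψ)).congr
    (indicator_fourier_ae_eq hwpos hψ).symm

/-- A pointwise Bessel inequality: the values at `x` of the Fourier integrals of
`1_S w^{-1/2} ψ i`, for orthonormal `ψ`, are square summable with sum at most `∫_S 1 / w`. -/
theorem sum_enorm_fourierInv_sq_le (hw : Measurable w) (hw0 : ∀ ξ, 0 ≤ w ξ)
    (hwpos : ∀ᵐ ξ, 0 < w ξ) (hS : MeasurableSet S)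
    (hfin : ∫⁻ ξ in S, ENNReal.ofReal (w ξ)⁻¹ ≠ ⊤) {n : ℕ} {ψ h : Fin n → L2 d}
    (hon : Orthonormal ℂ ψ) (hψ : ∀ i, ψ i =ᵐ[volume] fun ξ => (√(w ξ) : ℂ) * h i ξ)
    (x : Space d) :
    ∑ i, ‖𝓕⁻ (S.indicator (h i)) x‖ₑ ^ 2 ≤ ∫⁻ ξ in S, ENNReal.ofReal (w ξ)⁻¹ := by
  set κ : Space d → ℂ := S.indicator fun ξ => (((√(w ξ))⁻¹ : ℝ) : ℂ) with hκ
  have hκm := memLp_indicator_inv_sqrt hw hw0 hS hfin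
  have hκreal : ∀ ξ, conj (κ ξ) = κ ξ := fun ξ => by
    by_cases hmem : ξ ∈ S
    · simp [hκ, hmem, -Complex.ofReal_inv]
    · simp [hκ, hmem]
  have hnorm : ∀ ξ, ‖(Real.fourierChar (-inner ℝ ξ x) : ℂ) * κ ξ‖ = ‖κ ξ‖ := fun ξ => by
    rw [norm_mul, Circle.norm_coe, one_mul]
  -- For fixed `x`, evaluation of the Fourier integral at `x` is the inner product of `ψ i` with
  -- this function, whose norm does not depend on `x`.
  have hQm : MemLp (fun ξ => (Real.fourierChar (-inner ℝ ξ x) : ℂ) * κ ξ) 2 volume := by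
    refine hκm.of_le (AEStronglyMeasurable.mul ?_ hκm.1)
      (Filter.Eventually.of_forall fun ξ => (hnorm ξ).le)
    refine Continuous.aestronglyMeasurable ?_
    have := Real.continuous_fourierChar
    fun_prop
  set Q : L2 d := hQm.toLp with hQ
  have hinner : ∀ i, inner ℂ Q (ψ i) = 𝓕⁻ (S.indicator (h i)) x := fun i => by
    rw [L2.inner_def, Real.fourierInv_eq]
    apply integral_congr_ae
    filter_upwards [hQm.coeFn_toLp, indicator_fourier_ae_eq (S := S) hwpos (hψ i)] with ξ h1 h2
    rw [h1, h2, RCLike.inner_apply, map_mul, hκreal, Circle.smul_def, smul_eq_mul,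
      AddChar.map_neg_eq_inv, ← Circle.coe_inv_eq_conj, inv_inv]
    ring
  have hQn : ENNReal.ofReal (‖Q‖ ^ 2) = ∫⁻ ξ in S, ENNReal.ofReal (w ξ)⁻¹ := by
    rw [← lintegral_enorm_sq, ← lintegral_indicator hS]
    apply lintegral_congr_ae
    filter_upwards [hQm.coeFn_toLp] with ξ h1
    rw [h1, ← ofReal_norm, hnorm, ← ENNReal.ofReal_pow (norm_nonneg _)]
    by_cases hmem : ξ ∈ S
    · simp only [hκ, hmem, Set.indicator_of_mem]
      rw [Complex.norm_real, Real.norm_of_nonneg (by positivity), inv_pow, Real.sq_sqrt (hw0 ξ)]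
    · simp [hκ, hmem]
  have hb := hon.sum_inner_products_le Q (s := Finset.univ)
  rw [← hQn]
  refine le_trans (le_of_eq ?_) (ENNReal.ofReal_le_ofReal hb)
  rw [ENNReal.ofReal_sum_of_nonneg fun i _ => by positivity]
  refine Finset.sum_congr rfl fun i _ => ?_
  rw [← hinner, ← ofReal_norm, ENNReal.ofReal_pow (norm_nonneg _), norm_inner_symm]

/-- The part on `S` is written as a Fourier integral, defined at every point, so that the pointwise
Bessel bound applies; the complementary part is only needed in `L²`. -/
theorem ae_eq_add_fourierInv_indicator (hw : Measurable w) (hw0 : ∀ ξ, 0 ≤ w ξ)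
    (hwpos : ∀ᵐ ξ, 0 < w ξ) (hS : MeasurableSet S)
    (hfin : ∫⁻ ξ in S, ENNReal.ofReal (w ξ)⁻¹ ≠ ⊤) {ψ u : L2 d}
    (hψ : ψ =ᵐ[volume] fun ξ => (√(w ξ) : ℂ) * (𝓕 u : L2 d) ξ) :
    u =ᵐ[volume] fun x => (𝓕⁻ (restrictTo hS.compl (𝓕 u : L2 d)) : L2 d) x +
      𝓕⁻ (S.indicator (𝓕 u : L2 d)) x := by
  have hi := integrable_indicator_fourier hw hw0 hwpos hS hfin hψ
  have hr := coeFn_restrictTo hS (𝓕 u : L2 d)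
  have h1 := coeFn_fourierInv_ae_eq _ (hi.congr hr.symm)
  have h2 : u = 𝓕⁻ (restrictTo hS.compl (𝓕 u : L2 d)) + 𝓕⁻ (restrictTo hS (𝓕 u : L2 d)) := by
    have : (𝓕⁻ (restrictTo hS.compl (𝓕 u : L2 d) + restrictTo hS (𝓕 u : L2 d)) : L2 d) =
        𝓕⁻ (restrictTo hS.compl (𝓕 u : L2 d)) + 𝓕⁻ (restrictTo hS (𝓕 u : L2 d)) :=
      (Lp.fourierTransformₗᵢ (Space d) ℂ).symm.map_add _ _
    rw [← this, add_comm, restrictTo_add_compl]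
    exact ((Lp.fourierTransformₗᵢ (Space d) ℂ).symm_apply_apply u).symm
  have h3 := Lp.coeFn_add (𝓕⁻ (restrictTo hS.compl (𝓕 u : L2 d)) : L2 d)
    (𝓕⁻ (restrictTo hS (𝓕 u : L2 d)))
  rw [← h2] at h3
  filter_upwards [h1, h3] with x h4 h5
  rw [h5, Pi.add_apply, h4, Real.fourierInv_congr_ae hr]

/-- The difference of the two sides, with norms added on the left, is `((1-s)‖a‖ - s‖b‖)² /
(s(1-s))`. -/
theorem sq_enorm_add_le {s : ℝ} (hs : 0 < s) (hs1 : s < 1) (a b : ℂ) :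
    ‖a + b‖ₑ ^ 2 ≤ ENNReal.ofReal s⁻¹ * ‖a‖ₑ ^ 2 + ENNReal.ofReal (1 - s)⁻¹ * ‖b‖ₑ ^ 2 := by
  have h1 : 0 < 1 - s := by linarith
  simp only [← ofReal_norm]
  rw [← ENNReal.ofReal_pow (norm_nonneg _), ← ENNReal.ofReal_pow (norm_nonneg _),
    ← ENNReal.ofReal_pow (norm_nonneg _), ← ENNReal.ofReal_mul (by positivity),
    ← ENNReal.ofReal_mul (by positivity), ← ENNReal.ofReal_add (by positivity) (by positivity)]
  apply ENNReal.ofReal_le_ofReal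
  have h2 : ‖a + b‖ ^ 2 ≤ (‖a‖ + ‖b‖) ^ 2 := by
    gcongr
    exact norm_add_le a b
  refine h2.trans ?_
  have h3 : s⁻¹ * ‖a‖ ^ 2 + (1 - s)⁻¹ * ‖b‖ ^ 2 - (‖a‖ + ‖b‖) ^ 2 =
      ((1 - s) * ‖a‖ - s * ‖b‖) ^ 2 / (s * (1 - s)) := by
    field_simp
    ring
  have h4 : 0 ≤ ((1 - s) * ‖a‖ - s * ‖b‖) ^ 2 / (s * (1 - s)) := by positivity
  linarith

/-- The sum of all integer powers of `4` not exceeding `t` is at most `4 t`. -/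
theorem tsum_zpow_indicator_le {t : ℝ} (ht : 0 < t) :
    ∑' k : ℤ, (if (4 : ℝ) ^ k ≤ t then ENNReal.ofReal ((4 : ℝ) ^ k) else 0) ≤
      ENNReal.ofReal (4 * t) := by
  -- `4^K` is the largest power not exceeding `t`. Reindexing by `k = K - n` leaves a geometric
  -- series with sum `(4/3) 4^K`, so the constant `4` has room to spare.
  obtain ⟨K, hK1, hK2⟩ := exists_mem_Ico_zpow ht (show (1 : ℝ) < 4 by norm_num)
  have hinj : Function.Injective fun n : ℕ => K - (n : ℤ) := fun a b hab => by
    simpa using hab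
  rw [← hinj.tsum_eq]
  · have hterm : ∀ n : ℕ, (if (4 : ℝ) ^ (K - (n : ℤ)) ≤ t then
        ENNReal.ofReal ((4 : ℝ) ^ (K - (n : ℤ))) else 0) ≤
        ENNReal.ofReal ((4 : ℝ) ^ K * (1 / 4) ^ n) := fun n => by
      split_ifs
      · apply ENNReal.ofReal_le_ofReal
        rw [zpow_sub₀ (by norm_num), zpow_natCast, one_div, inv_pow, div_eq_mul_inv]
      · exact zero_le
    refine (ENNReal.tsum_le_tsum hterm).trans ?_
    have hsum : Summable fun n : ℕ => (4 : ℝ) ^ K * (1 / 4) ^ n :=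
      (summable_geometric_of_lt_one (by norm_num) (by norm_num)).mul_left _
    rw [← ENNReal.ofReal_tsum_of_nonneg (fun n => by positivity) hsum, tsum_mul_left,
      tsum_geometric_of_lt_one (by norm_num) (by norm_num)]
    apply ENNReal.ofReal_le_ofReal
    linarith
  · intro k hk
    have hk' : (4 : ℝ) ^ k ≤ t := by
      by_contra hc
      exact hk (if_neg hc)
    have h1 : k < K + 1 := (zpow_lt_zpow_iff_right₀ (by norm_num : (1 : ℝ) < 4)).1
      (hk'.trans_lt hK2)
    refine ⟨(K - k).toNat, ?_⟩
    show K - ((K - k).toNat : ℤ) = k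
    omega

/-- By Tonelli the sum over `k` is taken at fixed `ξ`, where it is at most `4 w(ξ)`, and `w|h|² =
|ψ|²`. -/
theorem tsum_lintegral_zpow_le (hw : Measurable w) (hwpos : ∀ᵐ ξ, 0 < w ξ) {ψ h : L2 d}
    (hψ : ψ =ᵐ[volume] fun ξ => (√(w ξ) : ℂ) * h ξ) :
    ∑' k : ℤ, ENNReal.ofReal ((4 : ℝ) ^ k) * ∫⁻ ξ in {ξ | w ξ < (4 : ℝ) ^ k}ᶜ, ‖h ξ‖ₑ ^ 2 ≤
      4 * ENNReal.ofReal (‖ψ‖ ^ 2) := by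
  have hS : ∀ k : ℤ, MeasurableSet {ξ | w ξ < (4 : ℝ) ^ k}ᶜ := fun k =>
    (measurableSet_lt hw measurable_const).compl
  have hm : AEMeasurable (fun ξ => ‖h ξ‖ₑ ^ 2) volume :=
    (Lp.aestronglyMeasurable h).enorm.pow_const 2
  have h1 : ∀ k : ℤ, ENNReal.ofReal ((4 : ℝ) ^ k) *
      ∫⁻ ξ in {ξ | w ξ < (4 : ℝ) ^ k}ᶜ, ‖h ξ‖ₑ ^ 2 =
      ∫⁻ ξ, (if (4 : ℝ) ^ k ≤ w ξ then ENNReal.ofReal ((4 : ℝ) ^ k) else 0) * ‖h ξ‖ₑ ^ 2 := by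
    intro k
    rw [← lintegral_const_mul'' _ hm.restrict, ← lintegral_indicator (hS k)]
    congr 1 with ξ
    by_cases hmem : (4 : ℝ) ^ k ≤ w ξ
    · simp [hmem, not_lt.2 hmem]
    · simp [hmem, not_le.1 hmem]
  simp_rw [h1]
  rw [← lintegral_tsum]
  · rw [← lintegral_enorm_sq, ← lintegral_const_mul'' _
      ((Lp.aestronglyMeasurable ψ).enorm.pow_const 2)]
    apply lintegral_mono_ae
    filter_upwards [hwpos, hψ] with ξ h2 h3
    rw [ENNReal.tsum_mul_right, h3, enorm_mul, mul_pow, ← mul_assoc]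
    gcongr
    refine (tsum_zpow_indicator_le h2).trans (le_of_eq ?_)
    rw [← ofReal_norm, Complex.norm_real, Real.norm_of_nonneg (Real.sqrt_nonneg _),
      ← ENNReal.ofReal_pow (Real.sqrt_nonneg _), Real.sq_sqrt h2.le,
      ENNReal.ofReal_mul (by norm_num)]
    norm_num
  · intro k
    refine AEMeasurable.mul (Measurable.aemeasurable ?_) hm
    exact Measurable.ite (measurableSet_le measurable_const hw) measurable_const measurable_const

end Weight

/-! ### Dyadic decomposition in position and Cwikel's bound -/

section Dyadic

variable {f w : Space d → ℝ} {α : ℝ}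

/-- The dyadic shell `{2^k < f / α ≤ 2^{k+1}}`. -/
def dyadicShell (f : Space d → ℝ) (α : ℝ) (k : ℤ) : Set (Space d) :=
  {x | f x / α ∈ Set.Ioc ((2 : ℝ) ^ k) ((2 : ℝ) ^ (k + 1))}

theorem measurableSet_dyadicShell (hf : Measurable f) (k : ℤ) :
    MeasurableSet (dyadicShell f α k) :=
  (hf.div_const α) measurableSet_Ioc

theorem pairwise_disjoint_dyadicShell : Pairwise (Function.onFun Disjoint (dyadicShell f α)) := by
  intro k l hkl
  refine Set.disjoint_left.2 fun x hk hl => hkl ?_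
  have h1 := (zpow_lt_zpow_iff_right₀ (by norm_num : (1 : ℝ) < 2)).1 (hk.1.trans_le hl.2)
  have h2 := (zpow_lt_zpow_iff_right₀ (by norm_num : (1 : ℝ) < 2)).1 (hl.1.trans_le hk.2)
  omega

theorem four_zpow (k : ℤ) : (4 : ℝ) ^ k = ((2 : ℝ) ^ k) ^ 2 := by
  rw [← zpow_natCast, ← zpow_mul, mul_comm, zpow_mul]
  norm_num

theorem sq_le_of_mem_dyadicShell (hα : 0 < α) {k : ℤ} {x : Space d}
    (hx : x ∈ dyadicShell f α k) : f x ^ 2 ≤ 4 * α ^ 2 * (4 : ℝ) ^ k := by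
  have h0 : (0 : ℝ) < 2 ^ k := by positivity
  have h1 : f x / α ≤ 2 ^ (k + 1) := hx.2
  have h2 : 0 < f x := by
    have := h0.trans hx.1
    rwa [lt_div_iff₀ hα, zero_mul] at this
  rw [zpow_add_one₀ (by norm_num), div_le_iff₀ hα] at h1
  calc f x ^ 2 ≤ (2 ^ k * 2 * α) ^ 2 := by gcongr
    _ = _ := by rw [four_zpow]; ring

theorem lt_sq_div_of_mem_dyadicShell {k : ℤ} {x : Space d}
    (hx : x ∈ dyadicShell f α k) : (4 : ℝ) ^ k < f x ^ 2 / α ^ 2 := by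
  have h0 : (0 : ℝ) < 2 ^ k := by positivity
  rw [four_zpow, ← div_pow]
  exact pow_lt_pow_left₀ hx.1 h0.le (by norm_num)

theorem lintegral_sq_le_tsum_dyadicShell (hf0 : ∀ x, 0 ≤ f x) (hf : Measurable f) (hα : 0 < α)
    (g : Space d → ℝ≥0∞) :
    ∫⁻ x, ENNReal.ofReal (f x ^ 2) * g x ≤
      ∑' k : ℤ, ∫⁻ x in dyadicShell f α k, ENNReal.ofReal (f x ^ 2) * g x := by
  refine le_trans ?_ (lintegral_iUnion_le _ _)
  rw [← lintegral_indicator (MeasurableSet.iUnion fun k => measurableSet_dyadicShell hf k)]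
  refine lintegral_mono fun x => ?_
  rcases (hf0 x).eq_or_lt with h | h
  · simp [← h]
  · obtain ⟨k, hk⟩ := exists_mem_Ioc_zpow (div_pos h hα) (show (1 : ℝ) < 2 by norm_num)
    rw [Set.indicator_of_mem (Set.mem_iUnion.2 ⟨k, hk⟩)]

/-- The cutoff `4^k` is tied to the shell, where `f²` is at most `4α² 4^k`. The pieces with `w ≥
4^k` are thus summable over `k` with a bound of order `α²`, and the remaining pieces must account
for the rest. -/
theorem one_sub_le_tsum_dyadicShell (hf0 : ∀ x, 0 ≤ f x) (hf : Measurable f) (hw : Measurable w)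
    (hw0 : ∀ ξ, 0 ≤ w ξ) (hwpos : ∀ᵐ ξ, 0 < w ξ)
    (hfin : ∀ k : ℤ, ∫⁻ ξ in {ξ | w ξ < (4 : ℝ) ^ k}, ENNReal.ofReal (w ξ)⁻¹ ≠ ⊤)
    (hα : 0 < α) (hα' : α < 1 / 4) {ψ u : L2 d} (hψ1 : ‖ψ‖ = 1)
    (hψ : ψ =ᵐ[volume] fun ξ => (√(w ξ) : ℂ) * (𝓕 u : L2 d) ξ)
    (hu : 1 ≤ ∫⁻ x, ENNReal.ofReal (f x ^ 2) * ‖u x‖ₑ ^ 2) :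
    ENNReal.ofReal ((1 - 4 * α) ^ 2) ≤
      ∑' k : ℤ, ∫⁻ x in dyadicShell f α k, ENNReal.ofReal (f x ^ 2) *
        ‖𝓕⁻ ({ξ | w ξ < (4 : ℝ) ^ k}.indicator (𝓕 u : L2 d)) x‖ₑ ^ 2 := by
  have hS : ∀ k : ℤ, MeasurableSet {ξ | w ξ < (4 : ℝ) ^ k} := fun k =>
    measurableSet_lt hw measurable_const
  have hf2 : Measurable fun x => ENNReal.ofReal (f x ^ 2) := (hf.pow_const 2).ennreal_ofReal
  have h1 : 0 < 1 - 4 * α := by linarith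
  -- The names refer to the size of `f w^{-1/2}`: `low` has `w ≥ 4^k`, hence high frequency, and
  -- `high` has `w < 4^k`.
  set low : ℤ → L2 d := fun k => 𝓕⁻ (restrictTo (hS k).compl (𝓕 u : L2 d)) with hlow
  set high : ℤ → Space d → ℂ := fun k => 𝓕⁻ ({ξ | w ξ < (4 : ℝ) ^ k}.indicator (𝓕 u : L2 d))
    with hhigh
  set I := ∑' k : ℤ, ∫⁻ x in dyadicShell f α k, ENNReal.ofReal (f x ^ 2) * ‖high k x‖ₑ ^ 2 with hI
  -- The weight `s = 4α` is the square root of the bound `16 α²` on the `low` part, whose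
  -- contribution becomes `4α`.
  have hstep : ∀ k : ℤ, ∫⁻ x in dyadicShell f α k, ENNReal.ofReal (f x ^ 2) * ‖u x‖ₑ ^ 2 ≤
      ENNReal.ofReal (4 * α)⁻¹ *
          (∫⁻ x in dyadicShell f α k, ENNReal.ofReal (f x ^ 2) * ‖low k x‖ₑ ^ 2) +
        ENNReal.ofReal (1 - 4 * α)⁻¹ *
          ∫⁻ x in dyadicShell f α k, ENNReal.ofReal (f x ^ 2) * ‖high k x‖ₑ ^ 2 := by
    intro k
    have hml : AEMeasurable (fun x => ENNReal.ofReal (f x ^ 2) * ‖low k x‖ₑ ^ 2)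
        (volume.restrict (dyadicShell f α k)) :=
      hf2.aemeasurable.mul ((Lp.aestronglyMeasurable (low k)).enorm.pow_const 2).restrict
    rw [← lintegral_const_mul'' _ hml, ← lintegral_const_mul' _ _ ENNReal.ofReal_ne_top,
      ← lintegral_add_left' (hml.const_mul _)]
    refine lintegral_mono_ae (ae_restrict_of_ae ?_)
    filter_upwards [ae_eq_add_fourierInv_indicator hw hw0 hwpos (hS k) (hfin k) hψ] with x hx
    rw [hx]
    calc _ ≤ ENNReal.ofReal (f x ^ 2) * (ENNReal.ofReal (4 * α)⁻¹ * ‖low k x‖ₑ ^ 2 +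
          ENNReal.ofReal (1 - 4 * α)⁻¹ * ‖high k x‖ₑ ^ 2) := by
            gcongr
            exact sq_enorm_add_le (by positivity) (by linarith) _ _
      _ = _ := by ring
  have hlowsum : ∑' k : ℤ, ∫⁻ x in dyadicShell f α k, ENNReal.ofReal (f x ^ 2) * ‖low k x‖ₑ ^ 2 ≤
      ENNReal.ofReal (16 * α ^ 2) := by
    calc _ ≤ ∑' k : ℤ, ENNReal.ofReal (4 * α ^ 2) * (ENNReal.ofReal ((4 : ℝ) ^ k) *
          ∫⁻ ξ in {ξ | w ξ < (4 : ℝ) ^ k}ᶜ, ‖(𝓕 u : L2 d) ξ‖ₑ ^ 2) := by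
            refine ENNReal.tsum_le_tsum fun k => ?_
            rw [← lintegral_fourierInv_restrictTo (hS k).compl, ← mul_assoc,
              ← ENNReal.ofReal_mul (by positivity)]
            calc _ ≤ ∫⁻ x in dyadicShell f α k,
                ENNReal.ofReal (4 * α ^ 2 * (4 : ℝ) ^ k) * ‖low k x‖ₑ ^ 2 := by
                  refine setLIntegral_mono' (measurableSet_dyadicShell hf k) fun x hx => ?_
                  gcongr
                  exact sq_le_of_mem_dyadicShell hα hx
              _ ≤ ∫⁻ x, ENNReal.ofReal (4 * α ^ 2 * (4 : ℝ) ^ k) * ‖low k x‖ₑ ^ 2 :=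
                  setLIntegral_le_lintegral _ _
              _ = _ := lintegral_const_mul' _ _ ENNReal.ofReal_ne_top
      _ ≤ ENNReal.ofReal (4 * α ^ 2) * (4 * ENNReal.ofReal (‖ψ‖ ^ 2)) := by
            rw [ENNReal.tsum_mul_left]
            gcongr
            exact tsum_lintegral_zpow_le hw hwpos hψ
      _ = _ := by
            rw [hψ1, one_pow, ENNReal.ofReal_one, mul_one, ← ENNReal.ofReal_ofNat,
              ← ENNReal.ofReal_mul (by positivity)]
            congr 1
            ring
  have htot : 1 ≤ ENNReal.ofReal (4 * α) + ENNReal.ofReal (1 - 4 * α)⁻¹ * I := by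
    refine hu.trans ((lintegral_sq_le_tsum_dyadicShell hf0 hf hα _).trans
      ((ENNReal.tsum_le_tsum hstep).trans ?_))
    rw [ENNReal.tsum_add, ENNReal.tsum_mul_left, ENNReal.tsum_mul_left]
    gcongr
    calc _ ≤ ENNReal.ofReal (4 * α)⁻¹ * ENNReal.ofReal (16 * α ^ 2) := by gcongr
      _ = _ := by
        rw [← ENNReal.ofReal_mul (by positivity)]
        congr 1
        field_simp
        norm_num
  have h2 : ENNReal.ofReal (1 - 4 * α) ≤ ENNReal.ofReal (1 - 4 * α)⁻¹ * I := by
    rw [ENNReal.ofReal_sub _ (by positivity), ENNReal.ofReal_one]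
    exact tsub_le_iff_left.2 htot
  calc _ = ENNReal.ofReal (1 - 4 * α) * ENNReal.ofReal (1 - 4 * α) := by
        rw [← ENNReal.ofReal_mul h1.le, sq]
    _ ≤ ENNReal.ofReal (1 - 4 * α) * (ENNReal.ofReal (1 - 4 * α)⁻¹ * I) := by gcongr
    _ = I := by
        rw [← mul_assoc, ← ENNReal.ofReal_mul h1.le, mul_inv_cancel₀ h1.ne', ENNReal.ofReal_one,
          one_mul]

/-- Cwikel's bound for the size of an orthonormal family on which `f(x) w(p)^{-1/2}` does not
decrease norms. -/
theorem card_mul_le_lintegral (hf0 : ∀ x, 0 ≤ f x) (hf : Measurable f) (hw : Measurable w)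
    (hw0 : ∀ ξ, 0 ≤ w ξ) (hwpos : ∀ᵐ ξ, 0 < w ξ)
    (hfin : ∀ k : ℤ, ∫⁻ ξ in {ξ | w ξ < (4 : ℝ) ^ k}, ENNReal.ofReal (w ξ)⁻¹ ≠ ⊤)
    (hα : 0 < α) (hα' : α < 1 / 4) {n : ℕ} {ψ u : Fin n → L2 d} (hon : Orthonormal ℂ ψ)
    (hψ : ∀ i, ψ i =ᵐ[volume] fun ξ => (√(w ξ) : ℂ) * (𝓕 (u i) : L2 d) ξ)
    (hu : ∀ i, 1 ≤ ∫⁻ x, ENNReal.ofReal (f x ^ 2) * ‖u i x‖ₑ ^ 2) :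
    n * ENNReal.ofReal ((1 - 4 * α) ^ 2) ≤
      ∫⁻ x, ENNReal.ofReal (f x ^ 2) *
        ∫⁻ ξ in {ξ | w ξ < f x ^ 2 / α ^ 2}, ENNReal.ofReal (w ξ)⁻¹ := by
  have hS : ∀ k : ℤ, MeasurableSet {ξ | w ξ < (4 : ℝ) ^ k} := fun k =>
    measurableSet_lt hw measurable_const
  calc _ = ∑ _i : Fin n, ENNReal.ofReal ((1 - 4 * α) ^ 2) := by simp
    _ ≤ ∑ i, ∑' k : ℤ, ∫⁻ x in dyadicShell f α k, ENNReal.ofReal (f x ^ 2) *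
        ‖𝓕⁻ ({ξ | w ξ < (4 : ℝ) ^ k}.indicator (𝓕 (u i) : L2 d)) x‖ₑ ^ 2 :=
      Finset.sum_le_sum fun i _ => one_sub_le_tsum_dyadicShell hf0 hf hw hw0 hwpos hfin hα hα'
        (hon.1 i) (hψ i) (hu i)
    _ = ∑' k : ℤ, ∫⁻ x in dyadicShell f α k, ENNReal.ofReal (f x ^ 2) *
        ∑ i, ‖𝓕⁻ ({ξ | w ξ < (4 : ℝ) ^ k}.indicator (𝓕 (u i) : L2 d)) x‖ₑ ^ 2 := by
      rw [← Summable.tsum_finsetSum fun i _ => ENNReal.summable]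
      congr 1 with k
      simp_rw [Finset.mul_sum]
      rw [lintegral_finsetSum]
      intro i _
      exact (hf.pow_const 2).ennreal_ofReal.mul ((continuous_fourierInv_of_integrable
        (integrable_indicator_fourier hw hw0 hwpos (hS k) (hfin k) (hψ i))).measurable.enorm.pow_const 2)
    _ ≤ ∑' k : ℤ, ∫⁻ x in dyadicShell f α k, ENNReal.ofReal (f x ^ 2) *
        ∫⁻ ξ in {ξ | w ξ < f x ^ 2 / α ^ 2}, ENNReal.ofReal (w ξ)⁻¹ := by
      refine ENNReal.tsum_le_tsum fun k => ?_
      refine setLIntegral_mono' (measurableSet_dyadicShell hf k) fun x hx => ?_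
      gcongr
      -- After Bessel the cutoff is enlarged from `4^k` to `f²/α²`, which no longer depends on `k`,
      -- so the shells can be reassembled.
      refine (sum_enorm_fourierInv_sq_le hw hw0 hwpos (hS k) (hfin k) hon hψ x).trans ?_
      exact lintegral_mono_set fun ξ hξ => lt_trans hξ (lt_sq_div_of_mem_dyadicShell hx)
    _ = ∫⁻ x in ⋃ k, dyadicShell f α k, ENNReal.ofReal (f x ^ 2) *
        ∫⁻ ξ in {ξ | w ξ < f x ^ 2 / α ^ 2}, ENNReal.ofReal (w ξ)⁻¹ :=
      (lintegral_iUnion (measurableSet_dyadicShell hf) pairwise_disjoint_dyadicShell _).symm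
    _ ≤ _ := setLIntegral_le_lintegral _ _

end Dyadic

end BoundStates

/-! ### Specialisation to the relativistic symbol -/

theorem theorem3p4 (d : ℕ) (hd : 3 ≤ d) (m : ℝ) (hm : 0 ≤ m)
    (V : BoundStates.Space d → ℝ) (hV : AEMeasurable V volume)
    (hVc : BoundStates.IsRelFormCompact (BoundStates.relSymbol d m) V)
    (α : ℝ) (hα : 0 < α) (hα' : α < 1 / 4) :
    BoundStates.numNegEigenvalues (BoundStates.relSymbol d m) V ≤
      ENNReal.ofReal (α ^ 2 / (1 - 4 * α) ^ 2) *
        ∫⁻ x, ENNReal.ofReal (BoundStates.GFun d m (max 0 (-V x) / α ^ 2)) := by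
  open BoundStates in
  set w : Space d → ℝ := fun ξ => relSymbol d m ((2 * Real.pi) • ξ) with hwdef
  -- A measurable representative of `V` is used because the dyadic shells of `f` must be measurable
  -- sets.
  set f : Space d → ℝ := fun x => √(max 0 (-hV.mk V x)) with hfdef
  have hf : Measurable f := (measurable_const.max hV.measurable_mk.neg).sqrt
  have hf0 : ∀ x, 0 ≤ f x := fun x => Real.sqrt_nonneg _
  have hf2 : ∀ x, f x ^ 2 = max 0 (-hV.mk V x) := fun x => Real.sq_sqrt (le_max_left _ _)
  have hw : Measurable w := (continuous_relSymbol m).measurable.comp (measurable_const_smul _)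
  have : Nontrivial (Space d) :=
    Module.nontrivial_of_finrank_pos (R := ℝ) (by rw [finrank_euclideanSpace_fin]; omega)
  have hwpos : ∀ᵐ ξ, 0 < w ξ := by
    filter_upwards [Measure.ae_ne volume (0 : Space d)] with ξ hξ
    exact relSymbol_pos (smul_ne_zero (by positivity) hξ)
  have h1 : 0 < 1 - 4 * α := by linarith
  refine numNegEigenvalues_le hwpos hV fun n ψ u hon hψ hu => ?_
  have hu' : ∀ i, 1 ≤ ∫⁻ x, ENNReal.ofReal (f x ^ 2) * ‖u i x‖ₑ ^ 2 := fun i => by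
    refine (hu i).trans (le_of_eq (lintegral_congr_ae ?_))
    filter_upwards [hV.ae_eq_mk] with x hx
    rw [hf2, ← hx]
  have key := card_mul_le_lintegral hf0 hf hw
    (fun ξ => relSymbol_nonneg m _) hwpos
    (fun k => ((lintegral_relSymbol_inv_le hd hm (by positivity)).trans_lt
      ENNReal.ofReal_lt_top).ne) hα hα' hon hψ hu'
  have hF : ∫⁻ x, ENNReal.ofReal (f x ^ 2) *
      ∫⁻ ξ in {ξ | w ξ < f x ^ 2 / α ^ 2}, ENNReal.ofReal (w ξ)⁻¹ ≤
      ENNReal.ofReal (α ^ 2) * ∫⁻ x, ENNReal.ofReal (GFun d m (max 0 (-V x) / α ^ 2)) := by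
    rw [← lintegral_const_mul' _ _ ENNReal.ofReal_ne_top]
    apply lintegral_mono_ae
    filter_upwards [hV.ae_eq_mk] with x hx
    rw [hx, ← hf2]
    -- The momentum integral bound needs a positive level `u = f²/α²`; where `f` vanishes the left
    -- side is zero. Otherwise `f² · G(u)/u = α² G(u)`.
    rcases (hf0 x).eq_or_lt with h | h
    · simp [← h]
    · calc _ ≤ ENNReal.ofReal (f x ^ 2) *
            ENNReal.ofReal (GFun d m (f x ^ 2 / α ^ 2) / (f x ^ 2 / α ^ 2)) := by
              gcongr
              exact lintegral_relSymbol_inv_le hd hm (by positivity)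
        _ = _ := by
              rw [← ENNReal.ofReal_mul (by positivity), ← ENNReal.ofReal_mul (by positivity)]
              congr 1
              field_simp
  rw [ENNReal.ofReal_div_of_pos (by positivity), div_eq_mul_inv, mul_right_comm, ← div_eq_mul_inv]
  exact (ENNReal.le_div_iff_mul_le (Or.inl (by positivity)) (Or.inl ENNReal.ofReal_ne_top)).2
    (key.trans hF)
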